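/- For a real number $p\ge 1$, let $\ell^p$ also denote the equivalence relation on the Polish space $\mathbb R^{\mathbb N}$ (with the product topology) given by $$x\mathrel{\ell^p}y\iff \sum_{k}|x_k-y_k|^p<\infty ,\qquad x,y\in\mathbb R^{\mathbb N}.$$ For equivalence relations $E$, $F$ on Polish spaces $X$, $Y$, write $E\le_B F$ if there is a Borel map $\vartheta\colon X\to Y$ such that $x\mathrel{E}y\iff\vartheta(x)\mathrel{F}\vartheta(y)$ for all $x,y\in X$, and write $E<_B F$ if $E\le_B F$ but not $F\le_B E$. **Theorem (Dougherty–Hjorth).** If $1\le p<q<\infty$, then $\ell^p<_B\ell^q$. -/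

import Mathlib

/-- Borel reducibility `E ≤_B F` of equivalence relations on Polish spaces `X`, `Y`: there is a
Borel map `f : X → Y` (a reduction) such that `x E y ↔ f x F f y` for all `x, y`. -/
def BorelReducible {X Y : Type*} [TopologicalSpace X] [PolishSpace X] [MeasurableSpace X]
    [BorelSpace X] [TopologicalSpace Y] [PolishSpace Y] [MeasurableSpace Y] [BorelSpace Y]
    (E : Setoid X) (F : Setoid Y) : Prop :=
  ∃ f : X → Y, Measurable f ∧ ∀ x y : X, E x y ↔ F (f x) (f y)

/-- Strict Borel reducibility `E <_B F`: `E ≤_B F` holds and `F ≤_B E` fails. -/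
def StrictlyBorelReducible {X Y : Type*} [TopologicalSpace X] [PolishSpace X] [MeasurableSpace X]
    [BorelSpace X] [TopologicalSpace Y] [PolishSpace Y] [MeasurableSpace Y] [BorelSpace Y]
    (E : Setoid X) (F : Setoid Y) : Prop :=
  BorelReducible E F ∧ ¬ BorelReducible F E

/-- Summability of `|x k| ^ p` is membership in the sequence space `ℓ^p`. -/
theorem summable_abs_rpow_iff_memℓp {p : ℝ} (hp : 1 ≤ p) (x : ℕ → ℝ) :
    (Summable fun k => |x k| ^ p) ↔ Memℓp x (ENNReal.ofReal p) := by
  have h0 : 0 ≤ p := zero_le_one.trans hp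
  have h : (ENNReal.ofReal p).toReal = p := ENNReal.toReal_ofReal h0
  rw [memℓp_gen_iff (by rw [h]; linarith), h]
  simp only [Real.norm_eq_abs]

/-- For `1 ≤ p`, the equivalence relation `ℓ^p` on the Polish space `ℝ^ℕ` (product topology):
`x ℓ^p y` iff `∑ₖ |x k - y k| ^ p < ∞`. It is the orbit equivalence relation of the additive
group of the Banach space `ℓ^p` acting on `ℝ^ℕ` by componentwise addition. -/
def lpEquiv (p : ℝ) (hp : 1 ≤ p) : Setoid (ℕ → ℝ) where
  r x y := Summable fun k => |x k - y k| ^ p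
  iseqv :=
    { refl := fun x => by
        have h0 : p ≠ 0 := (zero_lt_one.trans_le hp).ne'
        simp only [sub_self, abs_zero, Real.zero_rpow h0]
        exact summable_zero
      symm := fun {x y} h => by
        simpa only [abs_sub_comm] using h
      trans := fun {x y z} hxy hyz => by
        have h1 := (summable_abs_rpow_iff_memℓp hp fun k => x k - y k).1 hxy
        have h2 := (summable_abs_rpow_iff_memℓp hp fun k => y k - z k).1 hyz
        refine (summable_abs_rpow_iff_memℓp hp fun k => x k - z k).2 ?_
        have h3 := h1.add h2
        have h4 : (fun k => x k - z k) = (fun k => x k - y k) + fun k => y k - z k := by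
          funext k
          simp
        rw [h4]
        exact h3 }

/-! Positive part: for p < q the line with the metric |a - b|^(p/q) embeds, up to constants, into
ℓ^q distances. The map winds the line around circles at every dyadic scale 2^j, weighted by
2^(-jp/q) (`exists_snowflake_bounds`). Applying it in each coordinate reduces ℓ^p to ℓ^q.

Negative part: choose K_i with ∑ K_i^(-q) < ∞ = ∑ K_i^(-p), and restrict a supposed Borel reduction
to sequences in the grids (1/K_i)ℤ, each grid being used by infinitely many coordinates. Baire
category and fusion yield one coordinate n_i for each i such that, as y_i ranges over 0, …, K_i, the
reduction is modulo ℓ^p of the form j ↦ f_j(y_{c(j)}) with finite blocks c(j) = i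
(`exists_blockwise`).

The i-th block must then keep 0 and K_i uniformly apart, since these represent grid points at
distance 1. By convexity some step k_i → k_i + 1 costs at least a constant times K_i^(-p). Taking
all these steps at once is negligible in ℓ^q but not in ℓ^p, a contradiction
(`false_of_blockwise_summable_iff`). -/

/-! ### Snowflake embedding and the reduction of ℓ^p to ℓ^q -/

/-- The two coordinates of the unit circle parametrisation, indexed by `Bool`. -/
noncomputable def circleCoord (s : Bool) (t : ℝ) : ℝ := if s then Real.cos t else Real.sin t

theorem continuous_circleCoord (s : Bool) : Continuous (circleCoord s) := by
  unfold circleCoord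
  cases s
  · simpa using Real.continuous_sin
  · simpa using Real.continuous_cos

theorem abs_circleCoord_sub_le (s : Bool) (u v : ℝ) :
    |circleCoord s u - circleCoord s v| ≤ |u - v| := by
  unfold circleCoord
  cases s
  · simpa using Real.abs_sin_sub_sin_le u v
  · simpa using Real.abs_cos_sub_cos_le u v

theorem abs_circleCoord_sub_le_two (s : Bool) (u v : ℝ) :
    |circleCoord s u - circleCoord s v| ≤ 2 := by
  have key : ∀ w, |circleCoord s w| ≤ 1 := by
    intro w
    unfold circleCoord
    cases s
    · simpa using Real.abs_sin_le_one w
    · simpa using Real.abs_cos_le_one w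
  linarith [abs_sub (circleCoord s u) (circleCoord s v), key u, key v]

/-- Two angles at distance between `1` and `2` are separated by one of the two coordinates. -/
theorem exists_half_le_abs_circleCoord_sub {u v : ℝ} (h1 : 1 ≤ |u - v|) (h2 : |u - v| ≤ 2) :
    ∃ s, 1 / 2 ≤ |circleCoord s u - circleCoord s v| := by
  by_contra! h
  have hc := h true
  have hs := h false
  simp only [circleCoord, if_true, Bool.false_eq_true, if_false] at hc hs
  -- The squared chord is 2 - 2 cos(u - v) ≥ 8/9, whereas two coordinates below 1/2 would make it
  -- less than 1/2.
  have hcos : Real.cos (u - v) ≤ 5 / 9 := by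
    rw [← Real.cos_abs]
    refine le_trans ?_ Real.cos_one_le
    exact Real.cos_le_cos_of_nonneg_of_le_pi zero_le_one (by linarith [Real.pi_gt_three]) h1
  rw [Real.cos_sub] at hcos
  have hc2 := sq_lt_sq' (by linarith [abs_lt.1 hc]) (abs_lt.1 hc).2
  have hs2 := sq_lt_sq' (by linarith [abs_lt.1 hs]) (abs_lt.1 hs).2
  nlinarith [Real.sin_sq_add_cos_sq u, Real.sin_sq_add_cos_sq v]

/-- An embedding of the line, with the metric `|a - b| ^ (p / q)`, into sequences indexed by
`ℤ × Bool` with (formal) `ℓ^q` distances. -/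
noncomputable def snowflake (p q a : ℝ) (i : ℤ × Bool) : ℝ :=
  (2 : ℝ) ^ (-(i.1 * p / q)) * circleCoord i.2 ((2 : ℝ) ^ (i.1 : ℝ) * a)

theorem continuous_snowflake (p q : ℝ) (i : ℤ × Bool) :
    Continuous fun a => snowflake p q a i :=
  continuous_const.mul ((continuous_circleCoord _).comp (continuous_const.mul continuous_id))

theorem abs_snowflake_sub_rpow {p q : ℝ} (hq : 0 < q) (a b : ℝ) (i : ℤ × Bool) :
    |snowflake p q a i - snowflake p q b i| ^ q = (2 : ℝ) ^ (-(i.1 * p)) *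
      |circleCoord i.2 ((2 : ℝ) ^ (i.1 : ℝ) * a) - circleCoord i.2 ((2 : ℝ) ^ (i.1 : ℝ) * b)| ^ q := by
  unfold snowflake
  rw [← mul_sub, abs_mul, Real.mul_rpow (abs_nonneg _) (abs_nonneg _),
    abs_of_pos (by positivity), ← Real.rpow_mul zero_le_two]
  congr 2
  field_simp

/-- The profile of the `q`-th powers of the coordinates of a difference of two `snowflake`s. -/
noncomputable def snowflakeBound (p q : ℝ) (i : ℤ × Bool) : ℝ :=
  (2 : ℝ) ^ (-(i.1 * p)) * (min ((2 : ℝ) ^ (i.1 : ℝ)) 1) ^ q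

theorem snowflakeBound_nonneg (p q : ℝ) (i : ℤ × Bool) : 0 ≤ snowflakeBound p q i := by
  unfold snowflakeBound
  positivity

/-- Fine scales decay like 2^(-jp), using p > 0; coarse scales like 2^(-|j|(q-p)), using p < q. -/
theorem summable_snowflakeBound {p q : ℝ} (hp : 0 < p) (hpq : p < q) :
    Summable (snowflakeBound p q) := by
  have hgeom : ∀ r : ℝ, 0 < r → Summable fun n : ℕ => (2 : ℝ) ^ (-(n * r)) := by
    intro r hr
    have : (fun n : ℕ => (2 : ℝ) ^ (-(n * r))) = fun n : ℕ => ((2 : ℝ) ^ (-r)) ^ n := by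
      funext n
      rw [← Real.rpow_natCast, ← Real.rpow_mul zero_le_two]
      congr 1
      ring
    rw [this]
    exact summable_geometric_of_lt_one (by positivity)
      (Real.rpow_lt_one_of_one_lt_of_neg one_lt_two (by linarith))
  rw [summable_prod_of_nonneg (snowflakeBound_nonneg p q)]
  refine ⟨fun j => Summable.of_finite, ?_⟩
  simp only [tsum_bool]
  have : Summable fun j : ℤ => (2 : ℝ) ^ (-(j * p)) * (min ((2 : ℝ) ^ (j : ℝ)) 1) ^ q := by
    refine Summable.of_nat_of_neg ?_ ?_
    · refine (hgeom p hp).congr fun n => ?_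
      rw [min_eq_right (Real.one_le_rpow one_le_two (by positivity)), Real.one_rpow, mul_one]
      simp
    · refine (hgeom (q - p) (by linarith)).congr fun n => ?_
      rw [min_eq_left (Real.rpow_le_one_of_one_le_of_nonpos one_le_two (by simp)),
        ← Real.rpow_mul zero_le_two, ← Real.rpow_add two_pos]
      congr 1
      push_cast
      ring
  exact this.add this

theorem exists_dyadic_scale {d : ℝ} (hd : 0 < d) :
    ∃ n : ℤ, (2 : ℝ) ^ (n : ℝ) ≤ d ∧ d ≤ 2 * (2 : ℝ) ^ (n : ℝ) := by
  obtain ⟨n, h1, h2⟩ := exists_mem_Ico_zpow hd one_lt_two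
  refine ⟨n, by rwa [Real.rpow_intCast], ?_⟩
  rw [zpow_add_one₀ two_ne_zero] at h2
  rw [Real.rpow_intCast]
  linarith

/-- Recentring the scales at n, where |a - b| ≈ 2^n, extracts the factor |a - b|^p and leaves a
profile independent of a and b. -/
theorem abs_snowflake_sub_rpow_le {p q : ℝ} (hp : 0 < p) (hq : 0 < q) {a b : ℝ} {n : ℤ}
    (h1 : (2 : ℝ) ^ (n : ℝ) ≤ |a - b|) (h2 : |a - b| ≤ 2 * (2 : ℝ) ^ (n : ℝ)) (i : ℤ × Bool) :
    |snowflake p q a (i.1 - n, i.2) - snowflake p q b (i.1 - n, i.2)| ^ q ≤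
      2 ^ q * |a - b| ^ p * snowflakeBound p q i := by
  rw [abs_snowflake_sub_rpow hq, snowflakeBound]
  have hA : (2 : ℝ) ^ (-(((i.1 - n : ℤ) : ℝ) * p)) ≤ |a - b| ^ p * (2 : ℝ) ^ (-(i.1 * p)) := by
    have : (2 : ℝ) ^ (-(((i.1 - n : ℤ) : ℝ) * p))
        = ((2 : ℝ) ^ (n : ℝ)) ^ p * (2 : ℝ) ^ (-(i.1 * p)) := by
      rw [← Real.rpow_mul zero_le_two, ← Real.rpow_add two_pos]
      congr 1
      push_cast
      ring
    rw [this]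
    gcongr
  have hB : |circleCoord i.2 ((2 : ℝ) ^ ((i.1 - n : ℤ) : ℝ) * a) -
      circleCoord i.2 ((2 : ℝ) ^ ((i.1 - n : ℤ) : ℝ) * b)|
      ≤ 2 * min ((2 : ℝ) ^ (i.1 : ℝ)) 1 := by
    rw [mul_min_of_nonneg _ _ zero_le_two]
    refine le_min ?_ (by simpa using abs_circleCoord_sub_le_two _ _ _)
    refine (abs_circleCoord_sub_le _ _ _).trans ?_
    rw [← mul_sub, abs_mul, abs_of_pos (by positivity)]
    calc (2 : ℝ) ^ ((i.1 - n : ℤ) : ℝ) * |a - b|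
        ≤ (2 : ℝ) ^ ((i.1 - n : ℤ) : ℝ) * (2 * (2 : ℝ) ^ (n : ℝ)) := by gcongr
      _ = 2 * ((2 : ℝ) ^ ((i.1 - n : ℤ) : ℝ) * (2 : ℝ) ^ (n : ℝ)) := by ring
      _ = 2 * (2 : ℝ) ^ (i.1 : ℝ) := by
        rw [← Real.rpow_add two_pos]
        congr 2
        push_cast
        ring
  calc _ ≤ (|a - b| ^ p * (2 : ℝ) ^ (-(i.1 * p))) * (2 * min ((2 : ℝ) ^ (i.1 : ℝ)) 1) ^ q := by
        gcongr
    _ = _ := by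
        rw [Real.mul_rpow zero_le_two (by positivity)]
        ring

/-- The `q`-th power of the `ℓ^q` distance of two `snowflake`s is finite and comparable to
`|a - b| ^ p`. -/
theorem exists_snowflake_bounds {p q : ℝ} (hp : 0 < p) (hpq : p < q) :
    ∃ c C : ℝ, 0 < c ∧ ∀ a b : ℝ,
      (Summable fun i => |snowflake p q a i - snowflake p q b i| ^ q) ∧
      c * |a - b| ^ p ≤ ∑' i, |snowflake p q a i - snowflake p q b i| ^ q ∧
      ∑' i, |snowflake p q a i - snowflake p q b i| ^ q ≤ C * |a - b| ^ p := by
  have hq : 0 < q := hp.trans hpq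
  refine ⟨(1 / 2) ^ q / 2 ^ p, 2 ^ q * ∑' i, snowflakeBound p q i, by positivity,
    fun a b => ?_⟩
  rcases eq_or_ne a b with rfl | hab
  · simp [Real.zero_rpow hq.ne', Real.zero_rpow hp.ne', summable_zero]
  obtain ⟨n, h1, h2⟩ := exists_dyadic_scale (abs_pos.2 (sub_ne_zero.2 hab))
  let e : ℤ × Bool ≃ ℤ × Bool := (Equiv.subRight n).prodCongr (Equiv.refl Bool)
  have hle : ∀ i, |snowflake p q a (e i) - snowflake p q b (e i)| ^ q ≤
      2 ^ q * |a - b| ^ p * snowflakeBound p q i := abs_snowflake_sub_rpow_le hp hq h1 h2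
  have hb : Summable fun i => 2 ^ q * |a - b| ^ p * snowflakeBound p q i :=
    (summable_snowflakeBound hp hpq).mul_left _
  have hs' : Summable fun i => |snowflake p q a (e i) - snowflake p q b (e i)| ^ q :=
    Summable.of_nonneg_of_le (fun i => by positivity) hle hb
  have hs : Summable fun i => |snowflake p q a i - snowflake p q b i| ^ q :=
    e.summable_iff.1 hs'
  refine ⟨hs, ?_, ?_⟩
  · have hsc : (2 : ℝ) ^ ((-n : ℤ) : ℝ) * (2 : ℝ) ^ (n : ℝ) = 1 := by
      rw [← Real.rpow_add two_pos]
      simp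
    have habs : |(2 : ℝ) ^ ((-n : ℤ) : ℝ) * a - (2 : ℝ) ^ ((-n : ℤ) : ℝ) * b|
        = (2 : ℝ) ^ ((-n : ℤ) : ℝ) * |a - b| := by
      rw [← mul_sub, abs_mul, abs_of_pos (by positivity)]
    have hpos : (0 : ℝ) < (2 : ℝ) ^ ((-n : ℤ) : ℝ) := by positivity
    -- At scale -n the rescaled angles lie at distance between 1 and 2, so this single term already
    -- gives the lower bound.
    obtain ⟨s, hsep⟩ := exists_half_le_abs_circleCoord_sub
      (u := (2 : ℝ) ^ ((-n : ℤ) : ℝ) * a) (v := (2 : ℝ) ^ ((-n : ℤ) : ℝ) * b)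
      (by rw [habs, ← hsc]; gcongr)
      (by rw [habs]; nlinarith)
    refine le_trans ?_ (hs.le_tsum (-n, s) fun i _ => by positivity)
    rw [abs_snowflake_sub_rpow hq]
    have hA : |a - b| ^ p / 2 ^ p ≤ (2 : ℝ) ^ (-(((-n : ℤ) : ℝ) * p)) := by
      rw [div_le_iff₀ (by positivity)]
      calc |a - b| ^ p ≤ (2 * (2 : ℝ) ^ (n : ℝ)) ^ p := by gcongr
        _ = _ := by
          rw [Real.mul_rpow zero_le_two (by positivity), ← Real.rpow_mul zero_le_two, mul_comm]
          simp
    calc (1 / 2) ^ q / 2 ^ p * |a - b| ^ p = |a - b| ^ p / 2 ^ p * (1 / 2) ^ q := by ring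
      _ ≤ _ := by gcongr
  · rw [← e.tsum_eq fun i => |snowflake p q a i - snowflake p q b i| ^ q]
    refine (hs'.tsum_le_tsum hle hb).trans_eq ?_
    rw [tsum_mul_left]
    ring

theorem borelReducible_lpEquiv {p q : ℝ} (hp : 1 ≤ p) (hpq : p < q) :
    BorelReducible (lpEquiv p hp) (lpEquiv q (hp.trans hpq.le)) := by
  have hp0 : 0 < p := zero_lt_one.trans_le hp
  obtain ⟨c, C, hc, H⟩ := exists_snowflake_bounds hp0 hpq
  obtain ⟨e⟩ : Nonempty (ℕ × (ℤ × Bool) ≃ ℕ) := nonempty_equiv_of_countable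
  refine ⟨fun x k => snowflake p q (x (e.symm k).1) (e.symm k).2, ?_, fun x y => ?_⟩
  · exact measurable_pi_lambda _ fun k =>
      (continuous_snowflake p q _).measurable.comp (measurable_pi_apply _)
  change (Summable fun k => |x k - y k| ^ p) ↔ Summable fun k =>
    |snowflake p q (x (e.symm k).1) (e.symm k).2 - snowflake p q (y (e.symm k).1) (e.symm k).2| ^ q
  refine Iff.trans ?_ e.summable_iff
  rw [summable_prod_of_nonneg (fun i => by simp only [Function.comp]; positivity)]
  simp only [Function.comp, Equiv.symm_apply_apply]
  constructor
  · intro h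
    exact ⟨fun n => (H _ _).1, Summable.of_nonneg_of_le
      (fun n => tsum_nonneg fun i => by positivity) (fun n => (H _ _).2.2) (h.mul_left C)⟩
  · rintro ⟨-, h⟩
    refine (summable_mul_left_iff hc.ne').1
      (Summable.of_nonneg_of_le (fun n => by positivity) (fun n => (H _ _).2.1) h)

/-! ### Baire category on ℤ^ℕ -/

open Filter in
/-- Countably many Borel sets are simultaneously relatively open in a comeager set. -/
theorem exists_residual_forall_relatively_open {X ι : Type*} [TopologicalSpace X]
    [MeasurableSpace X] [BorelSpace X] [Countable ι] (B : ι → Set X)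
    (hB : ∀ i, MeasurableSet (B i)) :
    ∃ C ∈ residual X, ∀ i, ∃ U, IsOpen U ∧ ∀ x ∈ C, x ∈ B i ↔ x ∈ U := by
  choose U hU hBU using fun i => (hB i).residualEq_isOpen
  have : ∀ᶠ x in residual X, ∀ i, x ∈ B i ↔ x ∈ U i :=
    eventually_countable_forall.2 fun i => eventuallyEq_set.1 (hBU i)
  exact ⟨_, this, fun i => ⟨U i, hU i, fun x hx => hx i⟩⟩

open Filter in
/-- A comeager set contains a countable intersection of open sets which a dense set of points
enters under all translations from a countable family. -/
theorem exists_open_seq_dense_translates {X ι : Type*} [TopologicalSpace X] [BaireSpace X]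
    [AddGroup X] [ContinuousAdd X] [Countable ι] (v : ι → X) {C : Set X} (hC : C ∈ residual X) :
    ∃ O : ℕ → Set X, (∀ n, IsOpen (O n)) ∧ ⋂ n, O n ⊆ C ∧
      Dense {x | ∀ i, x + v i ∈ ⋂ n, O n} := by
  obtain ⟨t, htC, hG, hd⟩ := mem_residual.1 hC
  obtain ⟨O, hO, rfl⟩ := isGδ_iff_eq_iInter_nat.1 hG
  refine ⟨O, hO, htC, dense_of_mem_residual ?_⟩
  have : ∀ᶠ x in residual X, ∀ i, x + v i ∈ ⋂ n, O n :=
    eventually_countable_forall.2 fun i =>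
      (tendsto_residual_of_isOpenMap (Homeomorph.addRight (v i)).continuous
        (Homeomorph.addRight (v i)).isOpenMap).eventually (residual_of_dense_Gδ hG hd)
  exact this

open Filter in
/-- Long initial segments of a point of an open set of the Baire space force membership. -/
theorem eventually_agree_imp_mem {U : Set (ℕ → ℤ)} (hU : IsOpen U) {x : ℕ → ℤ} (hx : x ∈ U) :
    ∀ᶠ N in atTop, ∀ x' : ℕ → ℤ, (∀ k < N, x' k = x k) → x' ∈ U := by
  obtain ⟨_, ⟨z, n, rfl⟩, hz, hs⟩ :=
    (PiNat.isTopologicalBasis_cylinders fun _ => ℤ).exists_subset_of_mem_open hx hU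
  filter_upwards [eventually_ge_atTop n] with N hN x' hx'
  refine hs (PiNat.mem_cylinder_iff.2 fun i hi => ?_)
  rw [hx' i (hi.trans_le hN), PiNat.mem_cylinder_iff.1 hz i hi]

/-- A finite modification of `x`. -/
abbrev shift (x : ℕ → ℤ) (γ : ℕ →₀ ℤ) : ℕ → ℤ := x + ⇑γ

/-- The points at which shifting by `γ` changes the coordinates of `F` from `l` on by at most
`(1 / 2) ^ k` in (the `p`-th power of) `ℓ^p` norm. -/
def tailSet (F : (ℕ → ℤ) → ℕ → ℝ) (p : ℝ) (γ : ℕ →₀ ℤ) (l k : ℕ) : Set (ℕ → ℤ) :=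
  {x | ∀ m, ∑ j ∈ Finset.Ico l m, |F (shift x γ) j - F x j| ^ p ≤ (1 / 2) ^ k}

theorem measurable_shift (γ : ℕ →₀ ℤ) : Measurable fun x => shift x γ :=
  (continuous_id.add continuous_const).measurable

theorem measurableSet_tailSet {F : (ℕ → ℤ) → ℕ → ℝ} (hF : Measurable F) (p : ℝ) (γ : ℕ →₀ ℤ)
    (l k : ℕ) : MeasurableSet (tailSet F p γ l k) := by
  have hm : ∀ j, Measurable fun x => F x j := fun j => (measurable_pi_apply j).comp hF
  have hs : ∀ j, Measurable fun x => F (shift x γ) j := fun j => (hm j).comp (measurable_shift γ)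
  rw [tailSet, Set.ofPred_forall]
  refine MeasurableSet.iInter fun m =>
    measurableSet_le (Finset.measurable_sum _ fun j _ => ?_) measurable_const
  simp only [← Real.norm_eq_abs]
  exact ((hs j).sub (hm j)).norm.pow_const p

open Filter in
theorem eventually_mem_tailSet {F : (ℕ → ℤ) → ℕ → ℝ} {p : ℝ} {γ : ℕ →₀ ℤ} {x : ℕ → ℤ}
    (h : Summable fun j => |F (shift x γ) j - F x j| ^ p) (k : ℕ) :
    ∀ᶠ l in atTop, x ∈ tailSet F p γ l k := by
  have h1 := tendsto_sum_nat_add fun j => |F (shift x γ) j - F x j| ^ p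
  filter_upwards [h1.eventually_le_const (show (0 : ℝ) < (1 / 2) ^ k by positivity)] with l hl m
  refine le_trans ?_ hl
  rw [Finset.sum_Ico_eq_sum_range]
  simp only [add_comm l]
  exact ((summable_nat_add_iff l).2 h).sum_le_tsum _ fun j _ => by positivity

open Filter in
/-- A dense set of starting points and open sets cutting out a set on which a Borel map and the
tails of its finite shifts are under control. -/
theorem exists_generic {F : (ℕ → ℤ) → ℕ → ℝ} (hF : Measurable F) (p : ℝ) :
    ∃ O : ℕ → Set (ℕ → ℤ), (∀ n, IsOpen (O n)) ∧
      Dense {x | ∀ γ, shift x γ ∈ ⋂ n, O n} ∧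
      (∀ γ l k, ∃ U, IsOpen U ∧ ∀ x ∈ ⋂ n, O n, x ∈ tailSet F p γ l k ↔ x ∈ U) ∧
      (∀ γ j, ∀ ε > 0, ∀ x ∈ ⋂ n, O n, ∃ U, IsOpen U ∧ x ∈ U ∧
        ∀ x' ∈ ⋂ n, O n, x' ∈ U → |F (shift x' γ) j - F (shift x γ) j| ≤ ε) := by
  obtain ⟨C, hC, hCU⟩ := exists_residual_forall_relatively_open
    -- Tail sets, and preimages of rational intervals under the coordinates of shifted values; the
    -- latter give relative continuity.
    (fun i : ((ℕ →₀ ℤ) × ℕ × ℕ) ⊕ ((ℕ →₀ ℤ) × ℕ × ℚ × ℚ) => Sum.elim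
      (fun a => tailSet F p a.1 a.2.1 a.2.2)
      (fun a => {x | F (shift x a.1) a.2.1 ∈ Set.Ioo (a.2.2.1 : ℝ) a.2.2.2}) i) (by
      rintro (a | a)
      · exact measurableSet_tailSet hF p _ _ _
      · exact ((measurable_pi_apply _).comp (hF.comp (measurable_shift a.1))) measurableSet_Ioo)
  obtain ⟨O, hO, hOC, hd⟩ := exists_open_seq_dense_translates (fun γ : ℕ →₀ ℤ => ⇑γ) hC
  refine ⟨O, hO, hd, fun γ l k => ?_, fun γ j ε hε x hx => ?_⟩
  · obtain ⟨U, hU, h⟩ := hCU (Sum.inl (γ, l, k))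
    exact ⟨U, hU, fun x hx => h x (hOC hx)⟩
  · obtain ⟨a, ha1, ha2⟩ := exists_rat_btwn (sub_lt_self (F (shift x γ) j) hε)
    obtain ⟨b, hb1, hb2⟩ := exists_rat_btwn (lt_add_of_pos_right (F (shift x γ) j) hε)
    obtain ⟨U, hU, h⟩ := hCU (Sum.inr (γ, j, a, b))
    refine ⟨U, hU, (h x (hOC hx)).1 ⟨ha2, hb1⟩, fun x' hx' hxU => ?_⟩
    obtain ⟨h1, h2⟩ := (h x' (hOC hx')).2 hxU
    simp only at h1 h2
    rw [abs_le]
    constructor <;> linarith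

/-! ### Fusion along finite modifications -/

open Filter in
/-- One step of the fusion construction. -/
theorem exists_fusion_step {F : (ℕ → ℤ) → ℕ → ℝ} {p : ℝ}
    (hfin : ∀ x γ, Summable fun j => |F (shift x γ) j - F x j| ^ p)
    {O : ℕ → Set (ℕ → ℤ)} (hO : ∀ n, IsOpen (O n))
    (hd : Dense {x | ∀ γ, shift x γ ∈ ⋂ n, O n})
    (htail : ∀ γ l k, ∃ U, IsOpen U ∧ ∀ x ∈ ⋂ n, O n, x ∈ tailSet F p γ l k ↔ x ∈ U)
    (hcont : ∀ γ j, ∀ ε > 0, ∀ x ∈ ⋂ n, O n, ∃ U, IsOpen U ∧ x ∈ U ∧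
        ∀ x' ∈ ⋂ n, O n, x' ∈ U → |F (shift x' γ) j - F (shift x γ) j| ≤ ε)
    (i : ℕ) (x₀ : ℕ → ℤ) (l₀ N₀ : ℕ) (R : Finset (ℕ →₀ ℤ)) :
    ∃ (x : ℕ → ℤ) (l N : ℕ), (∀ k < N₀, x k = x₀ k) ∧ l₀ < l ∧ N₀ ≤ N ∧
      ∀ x' : ℕ → ℤ, (∀ k < N, x' k = x k) → ∀ γ ∈ R, shift x' γ ∈ O i ∧
        (x' ∈ ⋂ n, O n → x' ∈ tailSet F p γ l i ∧
          ∀ j < l, |F (shift x' γ) j - F (shift x γ) j| ≤ (1 / 2) ^ j) := by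
  obtain ⟨x, hxc, hx⟩ := hd.inter_open_nonempty _ (PiNat.isOpen_cylinder (fun _ => ℤ) x₀ N₀)
    ⟨x₀, PiNat.self_mem_cylinder x₀ N₀⟩
  have hx0 : x ∈ ⋂ n, O n := by simpa [shift] using hx 0
  obtain ⟨l, hl0, hl⟩ := ((eventually_gt_atTop l₀).and ((Finset.eventually_all R).2 fun γ _ =>
    eventually_mem_tailSet (hfin x γ) i)).exists
  have h1 : ∀ᶠ N in atTop, ∀ γ ∈ R, ∀ x' : ℕ → ℤ, (∀ k < N, x' k = x k) → shift x' γ ∈ O i := by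
    refine (Finset.eventually_all R).2 fun γ _ => ?_
    have hopen : IsOpen ((fun z => shift z γ) ⁻¹' O i) :=
      (hO i).preimage (continuous_id.add continuous_const)
    exact eventually_agree_imp_mem hopen (Set.mem_iInter.1 (hx γ) i)
  have h2 : ∀ᶠ N in atTop, ∀ γ ∈ R, ∀ x' : ℕ → ℤ, (∀ k < N, x' k = x k) →
      x' ∈ ⋂ n, O n → x' ∈ tailSet F p γ l i := by
    refine (Finset.eventually_all R).2 fun γ hγ => ?_
    obtain ⟨U, hU, h⟩ := htail γ l i
    filter_upwards [eventually_agree_imp_mem hU ((h x hx0).1 (hl γ hγ))] with N hN x' hx' hg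
    exact (h x' hg).2 (hN x' hx')
  have h3 : ∀ᶠ N in atTop, ∀ γ ∈ R, ∀ j ∈ Finset.range l, ∀ x' : ℕ → ℤ,
      (∀ k < N, x' k = x k) → x' ∈ ⋂ n, O n →
        |F (shift x' γ) j - F (shift x γ) j| ≤ (1 / 2) ^ j := by
    refine (Finset.eventually_all R).2 fun γ _ => (Finset.eventually_all _).2 fun j _ => ?_
    obtain ⟨U, hU, hxU, h⟩ := hcont γ j ((1 / 2) ^ j) (by positivity) x hx0
    filter_upwards [eventually_agree_imp_mem hU hxU] with N hN x' hx' hg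
    exact h x' hg (hN x' hx')
  obtain ⟨N, hN, h1, h2, h3⟩ := ((eventually_ge_atTop N₀).and (h1.and (h2.and h3))).exists
  exact ⟨x, l, N, PiNat.mem_cylinder_iff.1 hxc, hl0, hN, fun x' hx' γ hγ =>
    ⟨h1 γ hγ x' hx', fun hg => ⟨h2 γ hγ x' hx' hg, fun j hj =>
      h3 γ hγ j (Finset.mem_range.2 hj) x' hx' hg⟩⟩⟩

/-- Modify `g` at the positions `n i` by adding `y i`. -/
def insertAt (g : ℕ → ℤ) (n y : ℕ → ℕ) : ℕ → ℤ :=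
  fun k => g k + if n k.unpair.1 = k then (y k.unpair.1 : ℤ) else 0

/-- The finite modification that adds `y t` at the positions `n t` with `t < i`. -/
noncomputable def headShift (n y : ℕ → ℕ) (i : ℕ) : ℕ →₀ ℤ :=
  ∑ t ∈ Finset.range i, Finsupp.single (n t) (y t : ℤ)

theorem headShift_apply {n : ℕ → ℕ} (hn : ∀ i, (n i).unpair.1 = i) (y : ℕ → ℕ) (i k : ℕ) :
    headShift n y i k =
      if k.unpair.1 < i ∧ n k.unpair.1 = k then (y k.unpair.1 : ℤ) else 0 := by
  rw [headShift, Finsupp.finsetSum_apply]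
  simp only [Finsupp.single_apply]
  split_ifs with h
  · rw [Finset.sum_eq_single_of_mem k.unpair.1 (Finset.mem_range.2 h.1), if_pos h.2]
    intro t _ ht
    rw [if_neg]
    rintro rfl
    exact ht (hn t).symm
  · refine Finset.sum_eq_zero fun t ht => if_neg ?_
    rintro rfl
    rw [hn] at h
    exact h ⟨Finset.mem_range.1 ht, rfl⟩

theorem shift_insertAt_headShift {n : ℕ → ℕ} (hn : ∀ i, (n i).unpair.1 = i) (g : ℕ → ℤ)
    (y z : ℕ → ℕ) (i : ℕ) (hz : ∀ t < i, z t = 0) :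
    shift (insertAt g n z) (headShift n y i) = insertAt g n fun t => if t < i then y t else z t := by
  funext k
  simp only [shift, Pi.add_apply, headShift_apply hn, insertAt]
  have := hz k.unpair.1
  split_ifs <;> grind

/-- The outcome of the fusion construction. -/
theorem exists_fusion_sequence {F : (ℕ → ℤ) → ℕ → ℝ} {p : ℝ}
    (hfin : ∀ x γ, Summable fun j => |F (shift x γ) j - F x j| ^ p)
    {O : ℕ → Set (ℕ → ℤ)} (hO : ∀ n, IsOpen (O n))
    (hd : Dense {x | ∀ γ, shift x γ ∈ ⋂ n, O n})
    (htail : ∀ γ l k, ∃ U, IsOpen U ∧ ∀ x ∈ ⋂ n, O n, x ∈ tailSet F p γ l k ↔ x ∈ U)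
    (hcont : ∀ γ j, ∀ ε > 0, ∀ x ∈ ⋂ n, O n, ∃ U, IsOpen U ∧ x ∈ U ∧
        ∀ x' ∈ ⋂ n, O n, x' ∈ U → |F (shift x' γ) j - F (shift x γ) j| ≤ ε)
    (K : ℕ → ℕ) :
    ∃ (x : ℕ → ℕ → ℤ) (l N : ℕ → ℕ), StrictMono l ∧
      (∀ i, Nat.pair i (N i) < N (i + 1)) ∧
      (∀ i, ∀ k ≤ Nat.pair i (N i), x (i + 1) k = x i k) ∧
      ∀ i, ∀ x' : ℕ → ℤ, (∀ k < N i, x' k = x i k) → ∀ y ≤ K,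
        shift x' (headShift (fun t => Nat.pair t (N t)) y i) ∈ O i ∧
        (x' ∈ ⋂ n, O n →
          x' ∈ tailSet F p (headShift (fun t => Nat.pair t (N t)) y i) (l i) i ∧
          ∀ j < l i, |F (shift x' (headShift (fun t => Nat.pair t (N t)) y i)) j -
            F (shift (x i) (headShift (fun t => Nat.pair t (N t)) y i)) j| ≤ (1 / 2) ^ j) := by
  classical
  choose fx fl fN hagree hl hN hstep using exists_fusion_step hfin hO hd htail hcont
  -- The state holds the last point, the last cut `l`, the length to preserve (just past the new
  -- position) and all head shifts bounded by `K` so far.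
  let S : ℕ → (ℕ → ℤ) × ℕ × ℕ × Finset (ℕ →₀ ℤ) := fun i => i.rec (0, 0, 0, {0}) fun i s =>
    (fx i s.1 s.2.1 s.2.2.1 s.2.2.2, fl i s.1 s.2.1 s.2.2.1 s.2.2.2,
      Nat.pair i (fN i s.1 s.2.1 s.2.2.1 s.2.2.2) + 1,
      Finset.image₂ (fun γ (a : ℕ) =>
        γ + Finsupp.single (Nat.pair i (fN i s.1 s.2.1 s.2.2.1 s.2.2.2)) (a : ℤ))
        s.2.2.2 (Finset.range (K i + 1)))
  let x : ℕ → ℕ → ℤ := fun i => fx i (S i).1 (S i).2.1 (S i).2.2.1 (S i).2.2.2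
  let l : ℕ → ℕ := fun i => fl i (S i).1 (S i).2.1 (S i).2.2.1 (S i).2.2.2
  let N : ℕ → ℕ := fun i => fN i (S i).1 (S i).2.1 (S i).2.2.1 (S i).2.2.2
  have hR : ∀ y ≤ K, ∀ i, headShift (fun t => Nat.pair t (N t)) y i ∈ (S i).2.2.2 := by
    intro y hy i
    induction i with
    | zero => simp [headShift, S]
    | succ i ih =>
      rw [headShift, Finset.sum_range_succ]
      exact Finset.mem_image₂_of_mem ih (Finset.mem_range.2 (Nat.lt_succ_of_le (hy i)))
  refine ⟨x, l, N, strictMono_nat_of_lt_succ fun i => ?_, fun i => ?_, fun i k hk => ?_,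
    fun i x' hx' y hy => ?_⟩
  · exact hl (i + 1) (S (i + 1)).1 (S (i + 1)).2.1 (S (i + 1)).2.2.1 (S (i + 1)).2.2.2
  · exact hN (i + 1) (S (i + 1)).1 (S (i + 1)).2.1 (S (i + 1)).2.2.1 (S (i + 1)).2.2.2
  · exact hagree (i + 1) (S (i + 1)).1 (S (i + 1)).2.1 (S (i + 1)).2.2.1 (S (i + 1)).2.2.2 k
      (Nat.lt_succ_of_le hk)
  · exact hstep i (S i).1 (S i).2.1 (S i).2.2.1 (S i).2.2.2 x' hx' _ (hR y hy i)

/-! ### Block form of the Borel map -/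

/-- A nonnegative series converges iff it converges after grouping along finite fibers. -/
theorem summable_iff_summable_sum_fiber {f : ℕ → ℝ} (hf : ∀ j, 0 ≤ f j) {c : ℕ → ℕ}
    {J : ℕ → Finset ℕ} (hJ : ∀ i j, j ∈ J i ↔ c j = i) :
    Summable f ↔ Summable fun i => ∑ j ∈ J i, f j := by
  rw [← (Equiv.sigmaFiberEquiv c).summable_iff,
    summable_sigma_of_nonneg (fun x => by simpa using hf _)]
  have hfib : ∀ i, HasSum (fun j : {j // c j = i} => f j) (∑ j ∈ J i, f j) := by
    intro i
    have h := (J i).hasSum f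
    exact ((Equiv.subtypeEquivRight (hJ i)).hasSum_iff
      (f := fun j : {j // c j = i} => f j)).1 h
  constructor
  · rintro ⟨-, h⟩
    exact h.congr fun i => (hfib i).tsum_eq
  · intro h
    exact ⟨fun i => (hfib i).summable, h.congr fun i => (hfib i).tsum_eq.symm⟩

/-- A Borel map on the Baire space that sends finite modifications to `ℓ^p`-equivalent sequences
is, modulo `ℓ^p` and on a suitable infinite product of finite sets, of the form
`y ↦ (j ↦ f j (y (c j)))` with `c` finite-to-one. -/
theorem exists_blockwise {F : (ℕ → ℤ) → ℕ → ℝ} (hF : Measurable F) {p : ℝ} (hp : 1 ≤ p)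
    (hfin : ∀ x γ, Summable fun j => |F (shift x γ) j - F x j| ^ p) (K : ℕ → ℕ) :
    ∃ (g : ℕ → ℤ) (n : ℕ → ℕ) (c : ℕ → ℕ) (J : ℕ → Finset ℕ) (f : ℕ → ℕ → ℝ),
      (∀ i, (n i).unpair.1 = i) ∧ (∀ i j, j ∈ J i ↔ c j = i) ∧
      ∀ y ≤ K, lpEquiv p hp (F (insertAt g n y)) fun j => f j (y (c j)) := by
  have hp0 : 0 < p := zero_lt_one.trans_le hp
  obtain ⟨O, hO, hd, htail, hcont⟩ := exists_generic hF p
  obtain ⟨x, l, N, hl, hN, hx, hstep⟩ := exists_fusion_sequence hfin hO hd htail hcont K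
  set n : ℕ → ℕ := fun t => Nat.pair t (N t)
  have hn : ∀ i, (n i).unpair.1 = i := fun i => by simp [n]
  have hNn : ∀ i, N i ≤ n i := fun i => Nat.right_le_pair _ _
  have hnmono : StrictMono n := strictMono_nat_of_lt_succ fun i => (hN i).trans_le (hNn _)
  have hxm : ∀ i m, i ≤ m → ∀ k ≤ n i, x m k = x i k := by
    intro i m him k hk
    induction m, him using Nat.le_induction with
    | base => rfl
    | succ m him ih => rw [hx m k (hk.trans (hnmono.monotone him)), ih]
  -- The diagonal is the limit: coordinate k is frozen from stage k on, since k ≤ n k.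
  let g : ℕ → ℤ := fun k => x k k
  have hg : ∀ i, ∀ k < N i, g k = x i k := by
    intro i k hk
    rcases le_total k i with h | h
    · exact (hxm k i h k hnmono.le_apply).symm
    · exact hxm i k h k (hk.le.trans (hNn i))
  have hagree : ∀ i (z : ℕ → ℕ), (∀ t < i, z t = 0) → ∀ k < N i, insertAt g n z k = x i k := by
    intro i z hz k hk
    rw [← hg i k hk, insertAt, add_eq_left, ite_eq_right_iff]
    intro h
    rw [Nat.cast_eq_zero]
    refine hz _ (lt_of_not_ge fun hi => ?_)
    have := (hNn i).trans (hnmono.monotone hi)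
    omega
  have hmem : ∀ y ≤ K, insertAt g n y ∈ ⋂ m, O m := by
    intro y hy
    -- Erasing y below i gives a point that agrees with `x i` up to `N i`; the head shift restores
    -- y.
    refine Set.mem_iInter.2 fun i => ?_
    have h := (hstep i (insertAt g n fun t => if t < i then 0 else y t)
      (hagree i _ fun t ht => if_pos ht) y hy).1
    rw [shift_insertAt_headShift hn _ _ _ _ fun t ht => if_pos ht] at h
    convert h using 2
    funext t
    split_ifs <;> rfl
  -- Block i is [l i, l (i + 1)), except that block 0 also absorbs all j < l 0.
  let c : ℕ → ℕ := fun j => Nat.findGreatest (fun i => l i ≤ j) j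
  have hc1 : ∀ j, c j ≠ 0 → l (c j) ≤ j := fun j hj =>
    Nat.findGreatest_of_ne_zero (P := fun i => l i ≤ j) rfl hj
  have hc2 : ∀ j, j < l (c j + 1) := by
    intro j
    by_contra! h
    have h1 : c j + 1 ≤ j := hl.le_apply.trans h
    have h2 : c j + 1 ≤ c j := Nat.le_findGreatest (P := fun i => l i ≤ j) h1 h
    omega
  let J : ℕ → Finset ℕ := fun i => (Finset.range (l (i + 1))).filter fun j => c j = i
  have hJ : ∀ i j, j ∈ J i ↔ c j = i := by
    intro i j
    simp only [J, Finset.mem_filter, Finset.mem_range, and_iff_right_iff_imp]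
    rintro rfl
    exact hc2 j
  refine ⟨g, n, c, J, fun j a => F (insertAt g n (Pi.single (c j) a)) j, hn, hJ, fun y hy => ?_⟩
  refine (lpEquiv p hp).iseqv.trans
    (y := fun j => F (insertAt g n fun t => if t < c j + 1 then y t else 0) j) ?_ ?_
  -- Forgetting y beyond c j: both values at j are within (1/2)^j of the same shifted stage point.
  · change Summable fun j => _
    have hgeom : Summable fun j : ℕ => (2 * (1 / 2 : ℝ) ^ j) ^ p := by
      have : (fun j : ℕ => (2 * (1 / 2 : ℝ) ^ j) ^ p)
          = fun j : ℕ => 2 ^ p * ((1 / 2 : ℝ) ^ p) ^ j := by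
        funext j
        rw [Real.mul_rpow zero_le_two (by positivity), ← Real.rpow_natCast, ← Real.rpow_natCast,
          ← Real.rpow_mul (by norm_num), ← Real.rpow_mul (by norm_num), mul_comm p]
      rw [this]
      exact (summable_geometric_of_lt_one (by positivity)
        (Real.rpow_lt_one (by norm_num) (by norm_num) hp0)).mul_left _
    refine Summable.of_nonneg_of_le (fun j => by positivity) (fun j => ?_) hgeom
    refine Real.rpow_le_rpow (abs_nonneg _) ?_ hp0.le
    set i := c j + 1
    have h1 := ((hstep i (insertAt g n fun t => if t < i then 0 else y t)
      (hagree i _ fun t ht => if_pos ht) y hy).2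
        (hmem _ fun t => by dsimp only; split_ifs; exacts [Nat.zero_le _, hy t])).2 j (hc2 j)
    have h2 := ((hstep i (insertAt g n 0) (hagree i _ fun t ht => rfl) y hy).2
        (hmem _ fun t => Nat.zero_le _)).2 j (hc2 j)
    rw [shift_insertAt_headShift hn _ _ _ _ fun t ht => if_pos ht] at h1
    rw [shift_insertAt_headShift hn _ _ 0 _ fun t ht => rfl] at h2
    have hy' : (fun t => if t < i then y t else if t < i then 0 else y t) = y := by
      funext t
      split_ifs <;> rfl
    rw [hy'] at h1
    rw [abs_sub_comm] at h2
    refine (abs_sub_le _ _ _).trans ((add_le_add h1 h2).trans_eq (two_mul _).symm)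
  -- Forgetting y below m changes block m by at most (1/2)^m by the tail bound. Block 0 is dropped,
  -- as it may start before l 0.
  · change Summable fun j => _
    rw [summable_iff_summable_sum_fiber (fun j => by positivity) hJ, ← summable_nat_add_iff 1]
    refine Summable.of_nonneg_of_le (fun i => Finset.sum_nonneg fun j _ => by positivity)
      (fun i => ?_) ((summable_nat_add_iff 1).2 (summable_geometric_two))
    set m := i + 1
    have h1 := ((hstep m (insertAt g n (Pi.single m (y m)))
      (hagree m _ fun t ht => Pi.single_eq_of_ne ht.ne _) y hy).2
        (hmem _ fun t => by
          rcases eq_or_ne t m with rfl | h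
          · simpa using hy _
          · simp [Pi.single_eq_of_ne h])).1 (l (m + 1))
    rw [shift_insertAt_headShift hn _ _ _ _ fun t ht => Pi.single_eq_of_ne ht.ne _] at h1
    have hy' : (fun t => if t < m then y t else (Pi.single m (y m) : ℕ → ℕ) t)
        = fun t => if t < m + 1 then y t else 0 := by
      funext t
      rcases lt_trichotomy t m with h | rfl | h
      · rw [if_pos h, if_pos (by omega)]
      · simp
      · rw [if_neg (by omega), if_neg (by omega), Pi.single_eq_of_ne h.ne']
    rw [hy'] at h1
    refine le_trans ?_ h1
    have hsub : J m ⊆ Finset.Ico (l m) (l (m + 1)) := by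
      intro j hj
      have hcj := (hJ m j).1 hj
      have ha := hc1 j
      have hb := hc2 j
      rw [hcj] at ha hb
      exact Finset.mem_Ico.2 ⟨ha (Nat.succ_ne_zero i), hb⟩
    refine le_of_eq_of_le (Finset.sum_congr rfl fun j hj => ?_)
      (Finset.sum_le_sum_of_subset_of_nonneg hsub fun j _ _ => by positivity)
    beta_reduce
    rw [(hJ m j).1 hj]

/-! ### Finite grids and the failure of the converse reduction -/

open Finset in
/-- Along a chain `0, 1, …, m` some step carries at least the fraction `m ^ (-p)` of the total
`ℓ^p` distance (to the power `p`). -/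
theorem exists_large_step {p : ℝ} (hp : 1 ≤ p) (s : Finset ℕ) (f : ℕ → ℕ → ℝ) {m : ℕ}
    (hm : 0 < m) :
    ∃ k < m, ∑ j ∈ s, |f j 0 - f j m| ^ p ≤
      (m : ℝ) ^ p * ∑ j ∈ s, |f j k - f j (k + 1)| ^ p := by
  have hm' : (0 : ℝ) < m := Nat.cast_pos.2 hm
  have hpt : ∀ j, |f j 0 - f j m| ^ p ≤
      (m : ℝ) ^ (p - 1) * ∑ k ∈ range m, |f j k - f j (k + 1)| ^ p := by
    intro j
    rw [← Finset.sum_range_sub' (f j) m]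
    refine le_trans (Real.rpow_le_rpow (abs_nonneg _) (Finset.abs_sum_le_sum_abs _ _)
      (zero_le_one.trans hp)) ?_
    simpa using Real.rpow_sum_le_const_mul_sum_rpow (range m) (fun k => f j k - f j (k + 1)) hp
  have hsum : ∑ _k ∈ range m, (∑ j ∈ s, |f j 0 - f j m| ^ p) / m ≤
      ∑ k ∈ range m, (m : ℝ) ^ (p - 1) * ∑ j ∈ s, |f j k - f j (k + 1)| ^ p := by
    rw [sum_const, card_range, nsmul_eq_mul, mul_div_cancel₀ _ hm'.ne', ← mul_sum, sum_comm,
      mul_sum]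
    exact sum_le_sum fun j _ => hpt j
  obtain ⟨k, hk, h⟩ := exists_le_of_sum_le (nonempty_range_iff.2 hm.ne') hsum
  refine ⟨k, mem_range.1 hk, ?_⟩
  rw [div_le_iff₀ hm', mul_right_comm, ← Real.rpow_add_one hm'.ne', sub_add_cancel] at h
  exact h

open Filter in
/-- On products of finer and finer grids of `[0, 1]`, the relation `ℓ^q` is not induced by
`ℓ^p`-distances of blocks. -/
theorem false_of_blockwise_summable_iff {p q : ℝ} (hp : 1 ≤ p) {K : ℕ → ℕ}
    (hK : ∀ i, 0 < K i) (hKq : Summable fun i => ((K i : ℝ) ^ q)⁻¹)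
    (hKp : ¬ Summable fun i => ((K i : ℝ) ^ p)⁻¹) (J : ℕ → Finset ℕ) (f : ℕ → ℕ → ℝ)
    (h : ∀ y ≤ K, ∀ z ≤ K, (Summable fun i => |(y i : ℝ) / K i - z i / K i| ^ q) ↔
      Summable fun i => ∑ j ∈ J i, |f j (y i) - f j (z i)| ^ p) : False := by
  have hp0 : 0 < p := zero_lt_one.trans_le hp
  have hK' : ∀ i, (0 : ℝ) < K i := fun i => Nat.cast_pos.2 (hK i)
  -- Otherwise, jumping from 0 to K_i along a sparse set of i is ℓ^p-small, yet has infinitely many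
  -- ℓ^q terms equal to 1.
  have hlow : ∃ m : ℕ, ∀ᶠ i in atTop,
      (1 / 2 : ℝ) ^ m < ∑ j ∈ J i, |f j 0 - f j (K i)| ^ p := by
    by_contra! hcon
    have hfreq : ∀ m : ℕ, ∃ᶠ i in atTop,
        ∑ j ∈ J i, |f j 0 - f j (K i)| ^ p ≤ (1 / 2 : ℝ) ^ m := by
      intro m
      simpa [Filter.not_eventually] using hcon m
    obtain ⟨φ, hφ, hle⟩ := extraction_forall_of_frequently hfreq
    classical
    let y : ℕ → ℕ := fun i => if i ∈ Set.range φ then K i else 0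
    have hyφ : ∀ m, y (φ m) = K (φ m) := fun m => if_pos ⟨m, rfl⟩
    have hy0 : ∀ i, i ∉ Set.range φ → y i = 0 := fun i hi => if_neg hi
    have hy : y ≤ K := by
      intro i
      dsimp only [y]
      split_ifs
      exacts [le_rfl, Nat.zero_le _]
    have hs : Summable fun i => |((0 : ℕ → ℕ) i : ℝ) / K i - y i / K i| ^ q := by
      rw [h 0 (fun i => Nat.zero_le _) y hy, ← hφ.injective.summable_iff]
      · refine Summable.of_nonneg_of_le (fun m => Finset.sum_nonneg fun j _ => by positivity)
          (fun m => ?_) summable_geometric_two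
        simpa [hyφ] using hle m
      · intro i hi
        simp [hy0 i hi, Real.zero_rpow hp0.ne']
    have hs' := hs.comp_injective hφ.injective
    have hone : (fun i => |((0 : ℕ → ℕ) i : ℝ) / K i - y i / K i| ^ q) ∘ φ = fun _ => 1 := by
      funext m
      simp [hyφ, div_self (hK' _).ne']
    rw [hone] at hs'
    simpa using hs'.tendsto_atTop_zero
  obtain ⟨m, hm⟩ := hlow
  choose k hkK hk using fun i => exists_large_step hp (J i) f (hK i)
  have hs : Summable fun i => ∑ j ∈ J i, |f j (k i) - f j (k i + 1)| ^ p := by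
    refine (h k (fun i => (hkK i).le) (fun i => k i + 1) fun i => hkK i).1 (hKq.congr fun i => ?_)
    rw [← sub_div, Nat.cast_add_one, sub_add_cancel_left, abs_div, abs_neg, abs_one,
      abs_of_pos (hK' i), Real.div_rpow zero_le_one (hK' i).le, Real.one_rpow, one_div]
  refine hKp (Summable.of_norm_bounded_eventually_nat (hs.mul_left (2 ^ m)) ?_)
  filter_upwards [hm] with i hi
  have h1 := hi.le.trans (hk i)
  rw [Real.norm_of_nonneg (by positivity), inv_le_iff_one_le_mul₀ (by have := hK' i; positivity)]
  calc (1 : ℝ) = 2 ^ m * (1 / 2) ^ m := by rw [← mul_pow]; norm_num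
    _ ≤ 2 ^ m * ((K i : ℝ) ^ p * ∑ j ∈ J i, |f j (k i) - f j (k i + 1)| ^ p) := by gcongr
    _ = _ := by ring

theorem exists_grid_sizes {p q : ℝ} (hp : 0 < p) (hpq : p < q) :
    ∃ K : ℕ → ℕ, (∀ i, 0 < K i) ∧ (Summable fun i => ((K i : ℝ) ^ q)⁻¹) ∧
      ¬ Summable fun i => ((K i : ℝ) ^ p)⁻¹ := by
  have hpos : ∀ i : ℕ, (0 : ℝ) < ((i : ℝ) + 1) ^ (1 / p) := fun i => by positivity
  -- K_i^p is comparable to i + 1, so the p-series is harmonic and the q-series has exponent q/p >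
  -- 1.
  refine ⟨fun i => ⌈((i : ℝ) + 1) ^ (1 / p)⌉₊, fun i => Nat.ceil_pos.2 (hpos i), ?_, fun hs => ?_⟩
  · have h1 : Summable fun i : ℕ => (((i + 1 : ℕ) : ℝ) ^ (q / p))⁻¹ :=
      (summable_nat_add_iff 1).2 (Real.summable_nat_rpow_inv.2 ((one_lt_div hp).2 hpq))
    refine Summable.of_nonneg_of_le (fun i => by positivity) (fun i => ?_) h1
    refine inv_anti₀ (by positivity) ?_
    calc ((i + 1 : ℕ) : ℝ) ^ (q / p) = (((i : ℝ) + 1) ^ (1 / p)) ^ q := by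
          rw [← Real.rpow_mul (by positivity)]
          push_cast
          congr 1
          ring
      _ ≤ _ := Real.rpow_le_rpow (hpos i).le (Nat.le_ceil _) (hp.trans hpq).le
  · have h1 : Summable fun i : ℕ => (((i + 1 : ℕ) : ℝ))⁻¹ := by
      refine Summable.of_nonneg_of_le (fun i => by positivity) (fun i => ?_) (hs.mul_left (2 ^ p))
      have hone : (1 : ℝ) ≤ ((i : ℝ) + 1) ^ (1 / p) :=
        Real.one_le_rpow (by linarith [i.cast_nonneg (α := ℝ)]) (by positivity)
      have hceil : ((⌈((i : ℝ) + 1) ^ (1 / p)⌉₊ : ℕ) : ℝ) ≤ 2 * ((i : ℝ) + 1) ^ (1 / p) := by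
        linarith [Nat.ceil_lt_add_one (hpos i).le]
      have hC : (0 : ℝ) < ((⌈((i : ℝ) + 1) ^ (1 / p)⌉₊ : ℕ) : ℝ) :=
        (hpos i).trans_le (Nat.le_ceil _)
      have hle : ((⌈((i : ℝ) + 1) ^ (1 / p)⌉₊ : ℕ) : ℝ) ^ p ≤ 2 ^ p * ((i : ℝ) + 1) := by
        refine (Real.rpow_le_rpow (Nat.cast_nonneg _) hceil hp.le).trans_eq ?_
        rw [Real.mul_rpow zero_le_two (hpos i).le, ← Real.rpow_mul (by positivity),
          one_div_mul_cancel hp.ne', Real.rpow_one]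
      rw [← div_eq_mul_inv, le_div_iff₀ (by positivity), inv_mul_le_iff₀ (by positivity)]
      push_cast
      linarith
    exact Real.not_summable_natCast_inv ((summable_nat_add_iff 1).1 h1)

theorem summable_insertAt_sub_iff {q : ℝ} (hq : 0 < q) {n : ℕ → ℕ}
    (hn : ∀ i, (n i).unpair.1 = i) (g : ℕ → ℤ) (K y z : ℕ → ℕ) :
    (Summable fun k => |(insertAt g n y k : ℝ) / K k.unpair.1 -
        insertAt g n z k / K k.unpair.1| ^ q) ↔
      Summable fun i => |(y i : ℝ) / K i - z i / K i| ^ q := by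
  have hinj : Function.Injective n := fun a b hab => by rw [← hn a, ← hn b, hab]
  rw [← hinj.summable_iff]
  · refine summable_congr fun i => ?_
    simp only [Function.comp, insertAt, hn, if_true]
    push_cast
    congr 2
    ring
  · intro k hk
    have : ¬ n k.unpair.1 = k := fun h => hk ⟨_, h⟩
    simp [insertAt, this, Real.zero_rpow hq.ne']

theorem not_borelReducible_lpEquiv {p q : ℝ} (hp : 1 ≤ p) (hpq : p < q) :
    ¬ BorelReducible (lpEquiv q (hp.trans hpq.le)) (lpEquiv p hp) := by
  rintro ⟨θ, hθ, hred⟩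
  have hp0 : 0 < p := zero_lt_one.trans_le hp
  have hq : 0 < q := hp0.trans hpq
  obtain ⟨K, hK, hKq, hKp⟩ := exists_grid_sizes hp0 hpq
  -- Repeating each grid infinitely often lets fusion place n i arbitrarily late.
  let ι : (ℕ → ℤ) → ℕ → ℝ := fun x k => (x k : ℝ) / K k.unpair.1
  have hι : Measurable ι := measurable_pi_lambda _ fun k =>
    (measurable_from_top.comp (measurable_pi_apply k)).div_const _
  have hfin : ∀ x γ, Summable fun j => |θ (ι (shift x γ)) j - θ (ι x) j| ^ p := by
    intro x γ
    refine (hred (ι (shift x γ)) (ι x)).1 ?_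
    refine summable_of_ne_finset_zero (s := γ.support) fun k hk => ?_
    simp [ι, shift, Finsupp.notMem_support_iff.1 hk, Real.zero_rpow hq.ne']
  obtain ⟨g, n, c, J, f, hn, hJ, hf⟩ := exists_blockwise (hθ.comp hι) hp hfin K
  refine false_of_blockwise_summable_iff hp hK hKq hKp J f fun y hy z hz => ?_
  rw [← summable_insertAt_sub_iff hq hn g K y z]
  refine (hred (ι (insertAt g n y)) (ι (insertAt g n z))).trans ?_
  have hiff : lpEquiv p hp (θ (ι (insertAt g n y))) (θ (ι (insertAt g n z))) ↔
      lpEquiv p hp (fun j => f j (y (c j))) fun j => f j (z (c j)) :=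
    ⟨fun h => (lpEquiv p hp).iseqv.trans ((lpEquiv p hp).iseqv.symm (hf y hy))
        ((lpEquiv p hp).iseqv.trans h (hf z hz)),
      fun h => (lpEquiv p hp).iseqv.trans (hf y hy)
        ((lpEquiv p hp).iseqv.trans h ((lpEquiv p hp).iseqv.symm (hf z hz)))⟩
  refine hiff.trans ((summable_iff_summable_sum_fiber (fun j => by positivity) hJ).trans
    (summable_congr fun i => Finset.sum_congr rfl fun j hj => ?_))
  beta_reduce
  rw [(hJ i j).1 hj]

theorem mainTheorem8 (p q : ℝ) (hp : 1 ≤ p) (hpq : p < q) :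
    StrictlyBorelReducible (lpEquiv p hp) (lpEquiv q (hp.trans hpq.le)) :=
  ⟨borelReducible_lpEquiv hp hpq, not_borelReducible_lpEquiv hp hpq⟩
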